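/- Let $\mu>-1/2$. For $\alpha\in\mathbb R$ and $x>0$ let $K_\alpha(x)=\int_0^\infty e^{-x\cosh u}\cosh(\alpha u)\,du$ be the Macdonald function, and let $\nu_{e,\mu}$ and $\nu_{o,\mu}$ be the finite measures on $\mathbb C$ with densities $$\frac{2^{\frac12-\mu}}{\pi\,\Gamma(\mu+\frac12)}K_{\mu-\frac12}(|z|^2)\,|z|^{2\mu+1}\quad\text{and}\quad \frac{2^{\frac12-\mu}}{\pi\,\Gamma(\mu+\frac12)}K_{\mu+\frac12}(|z|^2)\,|z|^{2\mu+1}$$ ($z\neq0$) with respect to Lebesgue measure $dx\,dy$. Let $\mathcal B^2_{e,\mu}$ (respectively $\mathcal B^2_{o,\mu}$) be the space of all even (respectively odd) entire functions $f:\mathbb C\to\mathbb C$ belonging to $L^2(\mathbb C,\nu_{e,\mu})$ (respectively $L^2(\mathbb C,\nu_{o,\mu})$). For a finite measure $\nu$ and $f\in L^2(\nu)$ let $$S_{L^2(\nu)}(f)=\int |f|^2\log|f|^2\,d\nu-\|f\|_{L^2(\nu)}^2\log\|f\|_{L^2(\nu)}^2\in(-\infty,+\infty]\qquad(0\log0:=0),$$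 and let $E_{e,\mu}(f)=\int_{\mathbb C}|z|^2|f(z)|^2\,d\nu_{e,\mu}(z)\in[0,+\infty]$ for $f\in\mathcal B^2_{e,\mu}$ and $E_{o,\mu}(f)=\int_{\mathbb C}|z|^2|f(z)|^2\,d\nu_{o,\mu}(z)\in[0,+\infty]$ for $f\in\mathcal B^2_{o,\mu}$ be the $\mu$-deformed energies. Then there are finite constants $a_e>0$, $b_e>0$, $c_e\ge0$, depending only on $\mu$, such that for all $f_e\in\mathcal B^2_{e,\mu}$ $$a_e\,S_{L^2(\nu_{e,\mu})}(f_e)\le b_e\,E_{e,\mu}(f_e)+c_e\,\|f_e\|^2_{L^2(\nu_{e,\mu})},$$ and there are finite constants $a_o>0$, $b_o>0$, $c_o\ge0$, depending only on $\mu$, such that for all $f_o\in\mathcal B^2_{o,\mu}$ $$a_o\,S_{L^2(\nu_{o,\mu})}(f_o)\le b_o\,E_{o,\mu}(f_o)+c_o\,\|f_o\|^2_{L^2(\nu_{o,\mu})}.$$ Both inequalities are understood in $(-\infty,+\infty]$. -/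

import Mathlib

open MeasureTheory

namespace MuDeformed

/-- The Macdonald function (modified Bessel function of the third kind) `K_α`, given for `x > 0`
by `K_α(x) = ∫_0^∞ exp(-x cosh u) cosh(α u) du`. -/
noncomputable def macdonaldK (α x : ℝ) : ℝ :=
  ∫ u in Set.Ioi (0 : ℝ), Real.exp (-x * Real.cosh u) * Real.cosh (α * u)

/-- The density of `ν_{e,μ}` with respect to Lebesgue measure `dx dy` (meaningful for `z ≠ 0`). -/
noncomputable def evenDensity (μ : ℝ) (z : ℂ) : ℝ :=
  (2 : ℝ) ^ (1 / 2 - μ) / (Real.pi * Real.Gamma (μ + 1 / 2)) *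
    macdonaldK (μ - 1 / 2) (‖z‖ ^ 2) * ‖z‖ ^ (2 * μ + 1)

/-- The density of `ν_{o,μ}` with respect to Lebesgue measure `dx dy` (meaningful for `z ≠ 0`). -/
noncomputable def oddDensity (μ : ℝ) (z : ℂ) : ℝ :=
  (2 : ℝ) ^ (1 / 2 - μ) / (Real.pi * Real.Gamma (μ + 1 / 2)) *
    macdonaldK (μ + 1 / 2) (‖z‖ ^ 2) * ‖z‖ ^ (2 * μ + 1)

/-- The measure `ν_{e,μ}` on the complex plane. -/
noncomputable def evenMeasure (μ : ℝ) : Measure ℂ :=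
  (volume : Measure ℂ).withDensity fun z => ENNReal.ofReal (evenDensity μ z)

/-- The measure `ν_{o,μ}` on the complex plane. -/
noncomputable def oddMeasure (μ : ℝ) : Measure ℂ :=
  (volume : Measure ℂ).withDensity fun z => ENNReal.ofReal (oddDensity μ z)

/-- The even part `f_e(z) = (f(z) + f(-z)) / 2`. -/
noncomputable def evenPart (f : ℂ → ℂ) : ℂ → ℂ := fun z => (f z + f (-z)) / 2

/-- The odd part `f_o(z) = (f(z) - f(-z)) / 2`. -/
noncomputable def oddPart (f : ℂ → ℂ) : ℂ → ℂ := fun z => (f z - f (-z)) / 2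

/-- The `μ`-deformed Segal-Bargmann space `B²_μ`: entire functions whose even part is in
`L²(ν_{e,μ})` and whose odd part is in `L²(ν_{o,μ})`. -/
def segalBargmann (μ : ℝ) : Set (ℂ → ℂ) :=
  {f | Differentiable ℂ f ∧ MemLp (evenPart f) 2 (evenMeasure μ) ∧
    MemLp (oddPart f) 2 (oddMeasure μ)}

/-- The even subspace `B²_{e,μ}`. -/
def evenSegalBargmann (μ : ℝ) : Set (ℂ → ℂ) :=
  segalBargmann μ ∩ {f | f = evenPart f}

/-- The odd subspace `B²_{o,μ}`. -/
def oddSegalBargmann (μ : ℝ) : Set (ℂ → ℂ) :=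
  segalBargmann μ ∩ {f | f = oddPart f}

/-- The squared norm `‖f‖²` in `L²(ν)`, as a real number (used for `f ∈ L²(ν)` only). -/
noncomputable def l2NormSq {Ω : Type*} [MeasurableSpace Ω] (ν : Measure Ω) (f : Ω → ℂ) : ℝ :=
  (eLpNorm f 2 ν).toReal ^ 2

/-- The entropy `S_{L²(ν)}(f) = ∫ |f|² log |f|² dν - ‖f‖² log ‖f‖²` of `f ∈ L²(ν)`, where `ν` is a
finite measure. It takes values in `(-∞, +∞]`: the integral is the difference of the integrals of
the positive and the negative part of `|f|² log |f|²`, and the latter is finite because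
`r log r ≥ -1/e`. The convention `0 log 0 = 0` holds since `Real.log 0 = 0`. -/
noncomputable def entropy {Ω : Type*} [MeasurableSpace Ω] (ν : Measure Ω) (f : Ω → ℂ) : EReal :=
  ((∫⁻ ω, ENNReal.ofReal (‖f ω‖ ^ 2 * Real.log (‖f ω‖ ^ 2)) ∂ν : ENNReal) : EReal)
    - ((∫⁻ ω, ENNReal.ofReal (-(‖f ω‖ ^ 2 * Real.log (‖f ω‖ ^ 2))) ∂ν : ENNReal) : EReal)
    - ((l2NormSq ν f * Real.log (l2NormSq ν f) : ℝ) : EReal)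

/-- The `μ`-deformed energy `E_{e,μ}(f) = ∫ |z|² |f(z)|² dν_{e,μ}(z) ∈ [0, +∞]`. -/
noncomputable def evenEnergy (μ : ℝ) (f : ℂ → ℂ) : ENNReal :=
  ∫⁻ z, ENNReal.ofReal (‖z‖ ^ 2 * ‖f z‖ ^ 2) ∂(evenMeasure μ)

/-- The `μ`-deformed energy `E_{o,μ}(f) = ∫ |z|² |f(z)|² dν_{o,μ}(z) ∈ [0, +∞]`. -/
noncomputable def oddEnergy (μ : ℝ) (f : ℂ → ℂ) : ENNReal :=
  ∫⁻ z, ENNReal.ofReal (‖z‖ ^ 2 * ‖f z‖ ^ 2) ∂(oddMeasure μ)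

end MuDeformed

namespace MuDeformed

open Set Metric
open scoped ENNReal Real

/-! ### A lower bound for the Macdonald function -/

/-! The inequality follows from a pointwise growth bound. Off the unit disc both densities are at
least `k * exp (-β‖z‖²)` with `β = cosh 1` (`exp_neg_le_density`). The mean value property of the
entire function `f²` on unit discs then gives `‖f z‖² ≤ exp (2β‖z‖² + c) * ‖f‖²`
(`exists_norm_sq_le_exp_mul_l2NormSq`). Taking logarithms and integrating against `‖f‖²` bounds the
entropy by `2β` times the energy plus `c` times the squared norm (`entropy_le_of_norm_sq_le`).
Parity of `f` serves only to identify the measure in which it is square integrable. -/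

theorem sq_div_four_le_cosh {u : ℝ} (hu : 0 ≤ u) : u ^ 2 / 4 ≤ Real.cosh u := by
  have h1 := Real.quadratic_le_exp_of_nonneg hu
  have h2 := Real.exp_pos (-u)
  rw [Real.cosh_eq]
  linarith

theorem integrableOn_macdonaldK (α : ℝ) {x : ℝ} (hx : 0 < x) :
    IntegrableOn (fun u => Real.exp (-x * Real.cosh u) * Real.cosh (α * u)) (Ioi 0) := by
  have hdom : IntegrableOn (fun u : ℝ => Real.exp ((|α| + 1) ^ 2 / x) * Real.exp (-u)) (Ioi 0) :=
    (integrableOn_exp_neg_Ioi 0).const_mul _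
  refine Integrable.mono' hdom (Continuous.aestronglyMeasurable (by fun_prop)) ?_
  filter_upwards [ae_restrict_mem measurableSet_Ioi] with u hu
  have hu : 0 < u := hu
  have hcosh : Real.cosh (α * u) ≤ Real.exp (|α| * u) := by
    rw [← Real.cosh_abs, abs_mul, abs_of_pos hu, Real.cosh_eq]
    have : Real.exp (-(|α| * u)) ≤ Real.exp (|α| * u) := by
      apply Real.exp_le_exp.2
      have : 0 ≤ |α| * u := by positivity
      linarith
    linarith
  -- Completing the square in `u`; the extra 1 in `|α| + 1` leaves the integrable factor `exp (-u)`.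
  have hexp : -x * Real.cosh u + |α| * u ≤ (|α| + 1) ^ 2 / x + -u := by
    have h1 := mul_le_mul_of_nonneg_left (sq_div_four_le_cosh hu.le) hx.le
    have h2 : (|α| + 1) * u - x * (u ^ 2 / 4) ≤ (|α| + 1) ^ 2 / x := by
      rw [le_div_iff₀ hx]
      nlinarith [sq_nonneg (x * u / 2 - (|α| + 1))]
    linarith
  rw [Real.norm_of_nonneg (mul_nonneg (Real.exp_pos _).le (Real.cosh_pos _).le)]
  calc Real.exp (-x * Real.cosh u) * Real.cosh (α * u)
      ≤ Real.exp (-x * Real.cosh u) * Real.exp (|α| * u) := by gcongr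
    _ ≤ Real.exp ((|α| + 1) ^ 2 / x) * Real.exp (-u) := by
        rw [← Real.exp_add, ← Real.exp_add]
        exact Real.exp_le_exp.2 hexp

/-- Keep only `0 < u ≤ 1`, where `cosh u ≤ cosh 1`, and use `cosh (α * u) ≥ 1`. The rate is not
sharp but does not depend on `α`, so it serves both parities. -/
theorem exp_neg_le_macdonaldK (α : ℝ) {x : ℝ} (hx : 0 < x) :
    Real.exp (-(Real.cosh 1 * x)) ≤ macdonaldK α x := by
  have hint := integrableOn_macdonaldK α hx
  calc Real.exp (-(Real.cosh 1 * x))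
      = ∫ _ in Ioc (0 : ℝ) 1, Real.exp (-(Real.cosh 1 * x)) := by simp
    _ ≤ ∫ u in Ioc (0 : ℝ) 1, Real.exp (-x * Real.cosh u) * Real.cosh (α * u) := by
        refine setIntegral_mono_on (by simp) (hint.mono_set Ioc_subset_Ioi_self)
          measurableSet_Ioc fun u hu => ?_
        have hc : Real.cosh u ≤ Real.cosh 1 := by
          rw [Real.cosh_le_cosh, abs_of_pos hu.1, abs_one]
          exact hu.2
        have he : Real.exp (-(Real.cosh 1 * x)) ≤ Real.exp (-x * Real.cosh u) := by
          apply Real.exp_le_exp.2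
          nlinarith
        nlinarith [Real.one_le_cosh (α * u), Real.exp_pos (-x * Real.cosh u)]
    _ ≤ macdonaldK α x :=
        setIntegral_mono_set hint
          (ae_of_all _ fun u => mul_nonneg (Real.exp_pos _).le (Real.cosh_pos _).le)
          (LE.le.eventuallyLE Ioc_subset_Ioi_self)

/-- Since `2μ + 1 > 0`, the power of `‖z‖` can be dropped only where `‖z‖ ≥ 1`. -/
theorem exp_neg_le_density {μ : ℝ} (hμ : -1 / 2 < μ) (α : ℝ) {z : ℂ} (hz : 1 ≤ ‖z‖) :
    (2 : ℝ) ^ (1 / 2 - μ) / (Real.pi * Real.Gamma (μ + 1 / 2)) *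
        Real.exp (-(Real.cosh 1 * ‖z‖ ^ 2)) ≤
      (2 : ℝ) ^ (1 / 2 - μ) / (Real.pi * Real.Gamma (μ + 1 / 2)) *
        macdonaldK α (‖z‖ ^ 2) * ‖z‖ ^ (2 * μ + 1) := by
  have hΓ : 0 < Real.Gamma (μ + 1 / 2) := Real.Gamma_pos_of_pos (by linarith)
  have hK := exp_neg_le_macdonaldK α (x := ‖z‖ ^ 2) (by positivity)
  have hpow : 1 ≤ ‖z‖ ^ (2 * μ + 1) := Real.one_le_rpow hz (by linarith)
  have hK0 := (Real.exp_pos _).le.trans hK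
  rw [mul_assoc]
  gcongr
  nlinarith

/-! ### Pointwise bounds for entire functions -/

theorem two_pi_mul_enorm_le_lintegral_circle {g : ℂ → ℂ} (hg : Differentiable ℂ g) (r : ℝ) :
    ENNReal.ofReal (2 * π) * ‖g 0‖ₑ ≤ ∫⁻ θ in Ioo (-π) π, ‖g (circleMap 0 r θ)‖ₑ := by
  have hmean : Real.circleAverage g 0 r = g 0 := hg.diffContOnCl.circleAverage
  rw [Real.circleAverage_eq_integral_add (-π)] at hmean
  have hmean' : ∫ θ in Ioo (-π) π, g (circleMap 0 r θ) = (2 * π : ℝ) • g 0 := by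
    rw [← hmean, smul_smul, mul_inv_cancel₀ (by positivity), one_smul,
      intervalIntegral.integral_comp_add_right (fun θ => g (circleMap 0 r θ)),
      intervalIntegral.integral_of_le (by linarith [Real.pi_pos]), integral_Ioc_eq_integral_Ioo]
    congr 3 <;> ring
  calc ENNReal.ofReal (2 * π) * ‖g 0‖ₑ = ‖∫ θ in Ioo (-π) π, g (circleMap 0 r θ)‖ₑ := by
        rw [hmean', enorm_smul, Real.enorm_of_nonneg (by positivity)]
    _ ≤ _ := enorm_integral_le_lintegral_enorm _

/-- Integrate the mean value inequality on circles against `r dr` over `(0, 1)` and pass to polar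
coordinates. -/
theorem pi_mul_enorm_le_lintegral_ball_zero {g : ℂ → ℂ} (hg : Differentiable ℂ g) :
    ENNReal.ofReal π * ‖g 0‖ₑ ≤ ∫⁻ w in ball (0 : ℂ) 1, ‖g w‖ₑ := by
  have hmeas : Measurable fun p : ℝ × ℝ => ENNReal.ofReal p.1 * ‖g (circleMap 0 p.1 p.2)‖ₑ := by
    have : Continuous fun p : ℝ × ℝ => g (circleMap 0 p.1 p.2) := by
      refine hg.continuous.comp ?_
      unfold circleMap
      fun_prop
    exact (measurable_fst.ennreal_ofReal).mul this.measurable.enorm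
  have hr : ∫⁻ r in Ioo (0 : ℝ) 1, ENNReal.ofReal r = ENNReal.ofReal (1 / 2) := by
    rw [← ofReal_integral_eq_lintegral_ofReal]
    · rw [← integral_Ioc_eq_integral_Ioo, ← intervalIntegral.integral_of_le zero_le_one]
      simp
    · exact (continuous_id.integrableOn_Icc (a := (0 : ℝ)) (b := 1)).mono_set Ioo_subset_Icc_self
    · filter_upwards [ae_restrict_mem measurableSet_Ioo] with r hr using hr.1.le
  calc ENNReal.ofReal π * ‖g 0‖ₑ
      = ENNReal.ofReal (1 / 2) * (ENNReal.ofReal (2 * π) * ‖g 0‖ₑ) := by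
        rw [← mul_assoc, ← ENNReal.ofReal_mul (by norm_num)]
        congr 2
        ring
    _ = ∫⁻ r in Ioo (0 : ℝ) 1, ENNReal.ofReal r * (ENNReal.ofReal (2 * π) * ‖g 0‖ₑ) := by
        rw [lintegral_mul_const _ (by fun_prop), hr]
    _ ≤ ∫⁻ r in Ioo (0 : ℝ) 1, ∫⁻ θ in Ioo (-π) π,
          ENNReal.ofReal r * ‖g (circleMap 0 r θ)‖ₑ := by
        refine lintegral_mono fun r => ?_
        rw [lintegral_const_mul' _ _ ENNReal.ofReal_ne_top]
        gcongr
        exact two_pi_mul_enorm_le_lintegral_circle hg r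
    _ = ∫⁻ p in Ioo (0 : ℝ) 1 ×ˢ Ioo (-π) π,
          ENNReal.ofReal p.1 * ‖g (circleMap 0 p.1 p.2)‖ₑ := by
        rw [Measure.volume_eq_prod, ← Measure.prod_restrict, lintegral_prod _ hmeas.aemeasurable]
    _ = ∫⁻ p in Ioo (0 : ℝ) 1 ×ˢ Ioo (-π) π, ENNReal.ofReal p.1 •
          (ball (0 : ℂ) 1).indicator (fun w => ‖g w‖ₑ) (Complex.polarCoord.symm p) := by
        refine setLIntegral_congr_fun (measurableSet_Ioo.prod measurableSet_Ioo) fun p hp => ?_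
        have hp1 := hp.1
        have hpc : Complex.polarCoord.symm p = circleMap 0 p.1 p.2 := by
          rw [Complex.polarCoord_symm_apply, circleMap, Complex.exp_mul_I]
          simp
        have hmem : circleMap 0 p.1 p.2 ∈ ball (0 : ℂ) 1 := by
          simp [abs_of_pos hp1.1, hp1.2]
        simp only [hpc, indicator_of_mem hmem, smul_eq_mul]
    _ ≤ ∫⁻ p in polarCoord.target, ENNReal.ofReal p.1 •
          (ball (0 : ℂ) 1).indicator (fun w => ‖g w‖ₑ) (Complex.polarCoord.symm p) := by
        refine lintegral_mono_set ?_
        rw [polarCoord_target]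
        exact prod_mono Ioo_subset_Ioi_self subset_rfl
    _ = ∫⁻ w in ball (0 : ℂ) 1, ‖g w‖ₑ := by
        rw [Complex.lintegral_comp_polarCoord_symm, lintegral_indicator measurableSet_ball]

theorem pi_mul_enorm_le_lintegral_ball {g : ℂ → ℂ} (hg : Differentiable ℂ g) (z : ℂ) :
    ENNReal.ofReal π * ‖g z‖ₑ ≤ ∫⁻ w in ball z 1, ‖g w‖ₑ := by
  have h := pi_mul_enorm_le_lintegral_ball_zero
    (g := fun w => g (z + w)) (hg.comp (differentiable_id.const_add z))
  have hpre : (fun w => z + w) ⁻¹' ball z 1 = ball (0 : ℂ) 1 := by ext; simp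
  rwa [add_zero, ← hpre, (measurePreserving_add_left volume z).setLIntegral_comp_preimage_emb
    (measurableEmbedding_addLeft z) (fun w => ‖g w‖ₑ)] at h

theorem l2NormSq_eq_lintegral {Ω : Type*} [MeasurableSpace Ω] {ν : Measure Ω} {f : Ω → ℂ} :
    l2NormSq ν f = (∫⁻ ω, ‖f ω‖ₑ ^ 2 ∂ν).toReal := by
  have h := eLpNorm_nnreal_pow_eq_lintegral (f := f) (μ := ν) (p := 2) two_ne_zero
  rw [l2NormSq, ← ENNReal.toReal_pow]
  congr 1
  simpa using h

theorem lintegral_enorm_sq_lt_top {Ω : Type*} [MeasurableSpace Ω] {ν : Measure Ω} {f : Ω → ℂ}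
    (hf : MemLp f 2 ν) : ∫⁻ ω, ‖f ω‖ₑ ^ 2 ∂ν < ∞ := by
  have h := eLpNorm_nnreal_pow_eq_lintegral (f := f) (μ := ν) (p := 2) two_ne_zero
  have h' : eLpNorm f 2 ν ^ 2 = ∫⁻ ω, ‖f ω‖ₑ ^ 2 ∂ν := by simpa using h
  rw [← h']
  exact ENNReal.pow_lt_top hf.2

/-- Growth of entire functions that are square integrable for a measure whose density is at least
Gaussian outside the unit disc. -/
theorem exists_norm_sq_le_exp_mul_l2NormSq {ρ : ℂ → ℝ≥0∞} {k β : ℝ} (hk : 0 < k) (hβ : 0 < β)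
    (hρ : ∀ z, 1 ≤ ‖z‖ → ENNReal.ofReal (k * Real.exp (-(β * ‖z‖ ^ 2))) ≤ ρ z) :
    ∃ c : ℝ, 0 ≤ c ∧ ∀ f : ℂ → ℂ, Differentiable ℂ f → MemLp f 2 (volume.withDensity ρ) →
      ∀ z, ‖f z‖ ^ 2 ≤
        Real.exp (2 * β * ‖z‖ ^ 2 + c) * l2NormSq (volume.withDensity ρ) f := by
  set c₀ := |Real.log (π * k)| with hc₀
  have hpk : Real.exp (-c₀) ≤ π * k := by
    rw [← Real.le_log_iff_exp_le (by positivity)]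
    exact neg_abs_le _
  refine ⟨c₀ + 10 * β, by positivity, fun f hf hL z => ?_⟩
  set N := l2NormSq (volume.withDensity ρ) f with hN
  have hN0 : 0 ≤ N := by rw [hN, l2NormSq]; positivity
  -- For `‖z‖ ≥ 2` the unit disc around `z` stays where the lower bound on `ρ` is available.
  have hout : ∀ z : ℂ, 2 ≤ ‖z‖ → ‖f z‖ ^ 2 ≤ Real.exp (2 * β * ‖z‖ ^ 2 + 2 * β + c₀) * N := by
    intro z hz
    set m := k * Real.exp (-(β * (2 * ‖z‖ ^ 2 + 2))) with hm
    have hm0 : 0 < m := by positivity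
    have hlow : ∀ w ∈ ball z 1, ENNReal.ofReal m ≤ ρ w := by
      intro w hw
      have hd : ‖w - z‖ < 1 := by simpa [dist_eq_norm] using hw
      have h1 : 1 ≤ ‖w‖ := by
        have := norm_sub_norm_le z w
        rw [norm_sub_rev] at this
        linarith
      have h2 : ‖w‖ ≤ ‖z‖ + 1 := by
        have := norm_sub_norm_le w z
        linarith
      refine le_trans (ENNReal.ofReal_le_ofReal ?_) (hρ w h1)
      rw [hm]
      -- This doubling is the source of the factor 2 in the exponent `2β`.
      have : ‖w‖ ^ 2 ≤ 2 * ‖z‖ ^ 2 + 2 := by nlinarith [sq_nonneg (‖z‖ - 1), norm_nonneg w]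
      gcongr
    have hmeasure : (volume.restrict (ball z 1)).withDensity (fun _ => ENNReal.ofReal m) ≤
        volume.withDensity ρ := by
      rw [← withDensity_indicator measurableSet_ball]
      refine withDensity_mono (ae_of_all _ fun w => ?_)
      by_cases hw : w ∈ ball z 1
      · simpa [indicator_of_mem hw] using hlow w hw
      · simp [indicator_of_notMem hw]
    have hE : ENNReal.ofReal (m * (π * ‖f z‖ ^ 2)) ≤
        ∫⁻ w, ‖f w‖ₑ ^ 2 ∂(volume.withDensity ρ) := by
      calc ENNReal.ofReal (m * (π * ‖f z‖ ^ 2))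
          = ENNReal.ofReal m * (ENNReal.ofReal π * ‖f z ^ 2‖ₑ) := by
            rw [ENNReal.ofReal_mul hm0.le, ENNReal.ofReal_mul Real.pi_pos.le, ← norm_pow,
              ofReal_norm]
        _ ≤ ENNReal.ofReal m * ∫⁻ w in ball z 1, ‖f w ^ 2‖ₑ := by
            gcongr
            exact pi_mul_enorm_le_lintegral_ball (hf.pow 2) z
        _ = ∫⁻ w, ‖f w‖ₑ ^ 2
              ∂((volume.restrict (ball z 1)).withDensity fun _ => ENNReal.ofReal m) := by
            rw [withDensity_const, lintegral_smul_measure, smul_eq_mul]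
            simp only [enorm_pow]
        _ ≤ _ := lintegral_mono' hmeasure le_rfl
    have hreal : m * (π * ‖f z‖ ^ 2) ≤ N := by
      rw [hN, l2NormSq_eq_lintegral]
      exact (ENNReal.ofReal_le_iff_le_toReal (lintegral_enorm_sq_lt_top hL).ne).1 hE
    have hone : 1 ≤ Real.exp (2 * β * ‖z‖ ^ 2 + 2 * β + c₀) * (m * π) := by
      have : Real.exp (2 * β * ‖z‖ ^ 2 + 2 * β + c₀) * (m * π) = Real.exp c₀ * (π * k) := by
        rw [hm, show 2 * β * ‖z‖ ^ 2 + 2 * β + c₀ = β * (2 * ‖z‖ ^ 2 + 2) + c₀ by ring,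
          Real.exp_add, Real.exp_neg]
        field_simp
      rw [this]
      calc (1 : ℝ) = Real.exp c₀ * Real.exp (-c₀) := by rw [← Real.exp_add]; simp
        _ ≤ _ := by gcongr
    calc ‖f z‖ ^ 2 = 1 * ‖f z‖ ^ 2 := (one_mul _).symm
      _ ≤ Real.exp (2 * β * ‖z‖ ^ 2 + 2 * β + c₀) * (m * π) * ‖f z‖ ^ 2 := by gcongr
      _ = Real.exp (2 * β * ‖z‖ ^ 2 + 2 * β + c₀) * (m * (π * ‖f z‖ ^ 2)) := by ring
      _ ≤ _ := by gcongr
  rcases le_total 2 ‖z‖ with hz | hz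
  · refine (hout z hz).trans ?_
    gcongr ?_ * N
    apply Real.exp_le_exp.2
    linarith
  -- Near the origin the maximum principle for `f²` on the disc of radius 2 takes over; `10β = 2β *
  -- 2² + 2β`.
  · have hbd : ‖f z ^ 2‖ ≤ Real.exp (10 * β + c₀) * N := by
      refine Complex.norm_le_of_forall_mem_frontier_norm_le (f := fun w => f w ^ 2)
        (isBounded_ball (x := (0 : ℂ)) (r := 2)) (hf.pow 2).diffContOnCl (fun w hw => ?_) ?_
      · have hw2 : ‖w‖ = 2 := by simpa [frontier_ball] using hw
        have := hout w hw2.ge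
        rw [hw2] at this
        rw [norm_pow]
        refine this.trans_eq ?_
        congr 2
        ring
      · rw [closure_ball _ two_ne_zero]
        simpa using hz
    rw [norm_pow] at hbd
    refine hbd.trans ?_
    gcongr ?_ * N
    apply Real.exp_le_exp.2
    have : 0 ≤ 2 * β * ‖z‖ ^ 2 := by positivity
    linarith

/-! ### From pointwise bounds to entropy bounds -/

/-- A Gaussian pointwise bound gives an entropy bound. Finiteness of `ν` is not needed: if the
negative part of `|f|² log |f|²` had infinite integral, the left side would be `-∞`. -/
theorem entropy_le_of_norm_sq_le {ν : Measure ℂ} {f : ℂ → ℂ} (hf : MemLp f 2 ν) {b c : ℝ}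
    (hb : 0 < b)
    (hpt : ∀ z, ‖f z‖ ^ 2 ≤ Real.exp (b * ‖z‖ ^ 2 + c) * l2NormSq ν f) :
    entropy ν f ≤ (b : EReal) * ((∫⁻ z, ENNReal.ofReal (‖z‖ ^ 2 * ‖f z‖ ^ 2) ∂ν : ℝ≥0∞) : EReal)
      + ((c * l2NormSq ν f : ℝ) : EReal) := by
  set N := l2NormSq ν f with hN
  have hN0 : 0 ≤ N := by rw [hN, l2NormSq]; positivity
  set E := ∫⁻ z, ENNReal.ofReal (‖z‖ ^ 2 * ‖f z‖ ^ 2) ∂ν with hE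
  -- The logarithm of the pointwise bound needs `N > 0`; if `N = 0`, that bound forces `f = 0`.
  rcases hN0.eq_or_lt with hN1 | hNpos
  · have hzero : ∀ z, ‖f z‖ = 0 := by
      intro z
      have := hpt z
      rw [← hN1, mul_zero] at this
      exact pow_eq_zero_iff two_ne_zero |>.1 (le_antisymm this (by positivity))
    simp [entropy, hE, hzero, ← hN, ← hN1]
  by_cases hEtop : E = ∞
  · rw [hEtop, EReal.coe_ennreal_top, EReal.coe_mul_top_of_pos hb, EReal.top_add_coe]
    exact le_top
  have hmeas := hf.1
  have hsq : Integrable (fun z => ‖f z‖ ^ 2) ν := hf.integrable_norm_pow two_ne_zero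
  have hsqN : ∫ z, ‖f z‖ ^ 2 ∂ν = N := by
    rw [hN, l2NormSq_eq_lintegral, integral_eq_lintegral_of_nonneg_ae
      (ae_of_all _ fun z => by positivity) hsq.1]
    congr 1
    refine lintegral_congr fun z => ?_
    rw [← norm_pow, ofReal_norm, enorm_pow]
  have hEmeas : AEStronglyMeasurable (fun z => ‖z‖ ^ 2 * ‖f z‖ ^ 2) ν :=
    (Continuous.aestronglyMeasurable (by fun_prop)).mul hsq.1
  have hEint : Integrable (fun z => ‖z‖ ^ 2 * ‖f z‖ ^ 2) ν := by
    refine ⟨hEmeas, ?_⟩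
    rw [hasFiniteIntegral_iff_ofReal (ae_of_all _ fun z => by positivity)]
    exact lt_top_iff_ne_top.2 hEtop
  have hEval : ∫ z, ‖z‖ ^ 2 * ‖f z‖ ^ 2 ∂ν = E.toReal :=
    integral_eq_lintegral_of_nonneg_ae (ae_of_all _ fun z => by positivity) hEmeas
  have hle : ∀ z, ‖f z‖ ^ 2 * Real.log (‖f z‖ ^ 2) ≤
      (Real.log N + c) * ‖f z‖ ^ 2 + b * (‖z‖ ^ 2 * ‖f z‖ ^ 2) := by
    intro z
    rcases eq_or_ne (f z) 0 with h0 | h0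
    · simp [h0]
    have hlog : Real.log (‖f z‖ ^ 2) ≤ b * ‖z‖ ^ 2 + c + Real.log N := by
      rw [← Real.log_exp (b * ‖z‖ ^ 2 + c), ← Real.log_mul (Real.exp_pos _).ne' hNpos.ne']
      exact Real.log_le_log (by positivity) (hpt z)
    nlinarith [sq_nonneg ‖f z‖]
  have hint : Integrable
      (fun z => (Real.log N + c) * ‖f z‖ ^ 2 + b * (‖z‖ ^ 2 * ‖f z‖ ^ 2)) ν :=
    (hsq.const_mul _).add (hEint.const_mul _)
  set A := ∫⁻ z, ENNReal.ofReal (‖f z‖ ^ 2 * Real.log (‖f z‖ ^ 2)) ∂ν with hA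
  set B := ∫⁻ z, ENNReal.ofReal (-(‖f z‖ ^ 2 * Real.log (‖f z‖ ^ 2))) ∂ν with hB
  have hAtop : A ≠ ∞ := ne_top_of_le_ne_top hint.lintegral_lt_top.ne
    (lintegral_mono fun z => ENNReal.ofReal_le_ofReal (hle z))
  by_cases hBtop : B = ∞
  · rw [entropy, ← hB, hBtop]
    simp
  have hgmeas : AEStronglyMeasurable (fun z => ‖f z‖ ^ 2 * Real.log (‖f z‖ ^ 2)) ν :=
    hsq.1.mul (Real.measurable_log.comp_aemeasurable hsq.1.aemeasurable).aestronglyMeasurable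
  have hgint : Integrable (fun z => ‖f z‖ ^ 2 * Real.log (‖f z‖ ^ 2)) ν := by
    refine ⟨hgmeas, ?_⟩
    rw [hasFiniteIntegral_iff_norm]
    calc ∫⁻ z, ENNReal.ofReal ‖‖f z‖ ^ 2 * Real.log (‖f z‖ ^ 2)‖ ∂ν
        ≤ ∫⁻ z, (ENNReal.ofReal (‖f z‖ ^ 2 * Real.log (‖f z‖ ^ 2)) +
            ENNReal.ofReal (-(‖f z‖ ^ 2 * Real.log (‖f z‖ ^ 2)))) ∂ν := by
          refine lintegral_mono fun z => ?_
          rcases abs_cases (‖f z‖ ^ 2 * Real.log (‖f z‖ ^ 2)) with h | h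
          · rw [Real.norm_eq_abs, h.1]
            exact le_self_add
          · rw [Real.norm_eq_abs, h.1]
            exact le_add_self
      _ = A + B := lintegral_add_left' hgmeas.aemeasurable.ennreal_ofReal _
      _ < ∞ := ENNReal.add_lt_top.2 ⟨lt_top_iff_ne_top.2 hAtop, lt_top_iff_ne_top.2 hBtop⟩
  have hmain : A.toReal - B.toReal ≤ (Real.log N + c) * N + b * E.toReal := by
    rw [hA, hB, ← integral_eq_lintegral_pos_part_sub_lintegral_neg_part hgint, ← hsqN, ← hEval,
      hsqN, ← integral_const_mul]
    calc ∫ z, ‖f z‖ ^ 2 * Real.log (‖f z‖ ^ 2) ∂ν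
        ≤ ∫ z, ((Real.log N + c) * ‖f z‖ ^ 2 + b * (‖z‖ ^ 2 * ‖f z‖ ^ 2)) ∂ν :=
          integral_mono hgint hint hle
      _ = _ := by
          rw [integral_add (hsq.const_mul _) (hEint.const_mul _), integral_const_mul, hsqN]
  rw [entropy, ← hA, ← hB, ← hN, ← EReal.coe_ennreal_toReal hAtop,
    ← EReal.coe_ennreal_toReal hBtop, ← EReal.coe_ennreal_toReal hEtop]
  norm_cast
  -- The term `N * log N` in `hmain` cancels the one subtracted in the entropy.
  linarith

theorem exists_entropy_le {ρ : ℂ → ℝ≥0∞} {k β : ℝ} (hk : 0 < k) (hβ : 0 < β)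
    (hρ : ∀ z, 1 ≤ ‖z‖ → ENNReal.ofReal (k * Real.exp (-(β * ‖z‖ ^ 2))) ≤ ρ z) :
    ∃ a b c : ℝ, 0 < a ∧ 0 < b ∧ 0 ≤ c ∧ ∀ f : ℂ → ℂ, Differentiable ℂ f →
      MemLp f 2 (volume.withDensity ρ) →
      (a : EReal) * entropy (volume.withDensity ρ) f ≤
        (b : EReal) * ((∫⁻ z, ENNReal.ofReal (‖z‖ ^ 2 * ‖f z‖ ^ 2) ∂(volume.withDensity ρ) :
            ℝ≥0∞) : EReal)
          + ((c * l2NormSq (volume.withDensity ρ) f : ℝ) : EReal) := by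
  obtain ⟨c, hc, hbound⟩ := exists_norm_sq_le_exp_mul_l2NormSq hk hβ hρ
  refine ⟨1, 2 * β, c, one_pos, by positivity, hc, fun f hf hL => ?_⟩
  rw [EReal.coe_one, one_mul]
  exact entropy_le_of_norm_sq_le hL (by positivity) (hbound f hf hL)

end MuDeformed

theorem theorem4p6 (μ : ℝ) (hμ : -1 / 2 < μ) :
    (∃ a b c : ℝ, 0 < a ∧ 0 < b ∧ 0 ≤ c ∧
      ∀ f ∈ MuDeformed.evenSegalBargmann μ,
        (a : EReal) * MuDeformed.entropy (MuDeformed.evenMeasure μ) f ≤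
          (b : EReal) * (MuDeformed.evenEnergy μ f : EReal)
            + ((c * MuDeformed.l2NormSq (MuDeformed.evenMeasure μ) f : ℝ) : EReal)) ∧
    (∃ a b c : ℝ, 0 < a ∧ 0 < b ∧ 0 ≤ c ∧
      ∀ f ∈ MuDeformed.oddSegalBargmann μ,
        (a : EReal) * MuDeformed.entropy (MuDeformed.oddMeasure μ) f ≤
          (b : EReal) * (MuDeformed.oddEnergy μ f : EReal)
            + ((c * MuDeformed.l2NormSq (MuDeformed.oddMeasure μ) f : ℝ) : EReal)) := by
  have hΓ : 0 < Real.Gamma (μ + 1 / 2) := Real.Gamma_pos_of_pos (by linarith)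
  have hk : 0 < (2 : ℝ) ^ (1 / 2 - μ) / (Real.pi * Real.Gamma (μ + 1 / 2)) := by positivity
  constructor
  · obtain ⟨a, b, c, ha, hb, hc, h⟩ := MuDeformed.exists_entropy_le
      (ρ := fun z => ENNReal.ofReal (MuDeformed.evenDensity μ z)) hk (Real.cosh_pos 1)
      fun z hz => ENNReal.ofReal_le_ofReal (MuDeformed.exp_neg_le_density hμ (μ - 1 / 2) hz)
    refine ⟨a, b, c, ha, hb, hc, fun f hf => h f hf.1.1 ?_⟩
    have hfe : f = MuDeformed.evenPart f := hf.2
    have hL := hf.1.2.1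
    rwa [← hfe] at hL
  · obtain ⟨a, b, c, ha, hb, hc, h⟩ := MuDeformed.exists_entropy_le
      (ρ := fun z => ENNReal.ofReal (MuDeformed.oddDensity μ z)) hk (Real.cosh_pos 1)
      fun z hz => ENNReal.ofReal_le_ofReal (MuDeformed.exp_neg_le_density hμ (μ + 1 / 2) hz)
    refine ⟨a, b, c, ha, hb, hc, fun f hf => h f hf.1.1 ?_⟩
    have hfo : f = MuDeformed.oddPart f := hf.2
    have hL := hf.1.2.2
    rwa [← hfo] at hL
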